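/- **Setting.** The $\lambda_c$-terms are $t,u ::= x \mid tu \mid \lambda x.t \mid \mathsf{cc} \mid k_\pi \mid a_i \mid b_i$ ($i\in\mathbb N$; the $a_i$ are called nonrestricted, the $b_i$ restricted instructions), stacks are $\pi ::= \emptyset_i \mid t\cdot\pi$ ($i \in \mathbb N$, $t$ closed), processes are $t\star\pi$ ($t$ closed), all modulo $\alpha$-equivalence. $\Pi$ denotes the set of stacks. Evaluation is the smallest preorder $\succ_K$ on processes with $tu\star\pi\succ_K t\star u\cdot\pi$, $\lambda x.t\star u\cdot\pi\succ_K t[x:=u]\star\pi$, $\mathsf{cc}\star t\cdot\pi\succ_K t\star k_\pi\cdot\pi$, $k_{\pi'}\star t\cdot\pi\succ_K t\star\pi'$. A *pole* is a set $\bot\!\!\!\bot$ of processes such that $p\succ_K q\in\bot\!\!\!\bot$ implies $p\in\bot\!\!\!\bot$. A *realizability structure* is a set of poles. First-order terms are built from variables and all functions $f:\mathbb N^k\to\mathbb N$. Formulas are built from atoms $X(a_1,\dots,a_k)$ (propositional variables) and $F(a_1,\dots,a_k)$ ($F:\mathbb N^k\to\mathcal P(\Pi)$), $\top$, $\bot$,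 and $A\to B$, $\forall x\,A$, $\forall X\,A$, $(a=b)\mapsto A$, $A\cap B$, $A\cup B$. The falsity value of a closed formula with respect to a pole is given by $\|\top\|=\emptyset$, $\|\bot\|=\Pi$, $\|A\to B\|=\{t\cdot\pi: t \text{ realizes } A,\ \pi\in\|B\|\}$, $\|\forall x\,A\|=\bigcup_{m\in\mathbb N}\|A[x:=m]\|$, $\|\forall X\,A\|=\bigcup_{F}\|A[X:=F]\|$, $\|(a=b)\mapsto A\|=\|A\|$ if $a,b$ have the same value and $\emptyset$ otherwise, $\|A\cap B\|=\|A\|\cup\|B\|$, $\|A\cup B\|=\|A\|\cap\|B\|$, $\|F(\vec a)\|=F(\text{values of }\vec a)$; a closed term $t$ *realizes* $A$ if $t\star\pi\in\bot\!\!\!\bot$ for all $\pi\in\|A\|$. A closed term is *proof-like* if it contains no $k_\pi$ and no $b_i$. The *theory* $\mathrm{Th}(\mathcal S)$ of a realizability structure $\mathcal S$ is the set of closed formulas $A$ for which some proof-like term realizes $A$ with respect to every pole in $\mathcal S$; $\mathcal S$ is *consistent* if $\bot\notin\mathrm{Th}(\mathcal S)$. We write $a=b$ for $\forall Z\,(Z(a)\to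 Z(b))$, $a\ne b$ for $(a=b)\mapsto\bot$, and $A\wedge B$, $A\vee B$ for their usual second-order encodings. The formulas of the language of Boolean algebras are built from $\top$, $\bot$, $a=b$, $a\neq b$ by $\to,\wedge,\vee,\forall x$, where the terms $a,b$ are built from variables, $0,1,\vee,\wedge,\neg$. For such a formula $A$, $\gimel 2\models A$ (where $\gimel 2$ is the characteristic Boolean algebra) is the realizability formula obtained by reading $\vee,\wedge,\neg$ as the Boolean operations on $\{0,1\}$, extended to $\mathbb N$ by treating every positive number as $1$, and by replacing each $\forall x\,C$ by $\forall x\,\big((\min(x+1,2)=x+1)\mapsto C\big)$. Let $|\gimel 2|<k$ be the formula $\gimel 2\models\forall x_1\dots x_k\bigvee_{i\neq j}x_i=x_j$ (an empty disjunction being $\bot$); let $|\gimel 2|\le k$ be $|\gimel 2|<k+1$, let $|\gimel 2|\ge k$ be $(|\gimel 2|<k)\to\bot$, and let $|\gimel 2|=k$ be $(|\gimel 2|\ge k)\wedge(|\gimel 2|<k+1)$. **Theorem.** For every positive integer $n$ there is a consistent realizability structure $\mathcal S$ such that 1. the formula $|\gimel 2|=2^n$ belongs to $\mathrm{Th}(\mathcal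 S)$; 2. for every natural number $m$, the formula $|\gimel 2|\le 2^m$ belongs to $\mathrm{Th}(\mathcal S)$ if and only if $n\le m$ (so the hierarchy of the formulas $|\gimel 2|\le 2^m$, $m\ge 1$, does not collapse); 3. for every Boolean algebra $B$ with exactly $2^n$ elements and every closed formula $A$ of the language of Boolean algebras, $(\gimel 2\models A)\in\mathrm{Th}(\mathcal S)$ if and only if $A$ is true in $B$. Since the number of elements of a finite Boolean algebra is a power of $2$, (3) says that $\gimel 2$ can be made elementarily equivalent to any finite Boolean algebra with at least two elements. -/

import Mathlib

namespace ClassicalRealizability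

/-! ### The `λ_c`-calculus

Terms modulo α-equivalence are represented by well-scoped de Bruijn terms: `LTerm k` is the type of
`λ_c`-terms whose free variables are among `k` given ones, the variable `0` being the one bound by
the innermost abstraction. Closed terms are the elements of `LTerm 0`. -/

mutual

/-- `λ_c`-terms with free variables among `k` variables. -/
inductive LTerm : ℕ → Type
  | var {k : ℕ} (x : Fin k) : LTerm k
  | app {k : ℕ} (t u : LTerm k) : LTerm k
  | lam {k : ℕ} (t : LTerm (k + 1)) : LTerm k
  /-- call-with-current-continuation -/
  | cc {k : ℕ} : LTerm k
  /-- the continuation constant `k_π` -/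
  | cont {k : ℕ} (π : Stack) : LTerm k
  /-- nonrestricted instructions -/
  | instr {k : ℕ} (i : ℕ) : LTerm k
  /-- restricted instructions -/
  | restr {k : ℕ} (i : ℕ) : LTerm k

/-- Stacks: finite lists of closed terms, ended by a stack bottom. -/
inductive Stack : Type
  | bottom (i : ℕ) : Stack
  | push (t : LTerm 0) (π : Stack) : Stack

end

/-- Closed terms. -/
abbrev CTerm : Type := LTerm 0

/-- Renaming of the free variables of a term. (A continuation constant has no free variable.) -/
def LTerm.rename : {k l : ℕ} → (Fin k → Fin l) → LTerm k → LTerm l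
  | _, _, ρ, .var x => .var (ρ x)
  | _, _, ρ, .app t u => .app (t.rename ρ) (u.rename ρ)
  | _, _, ρ, .lam t => .lam (t.rename (Fin.cases 0 (fun x => (ρ x).succ)))
  | _, _, _, .cc => .cc
  | _, _, _, .cont π => .cont π
  | _, _, _, .instr i => .instr i
  | _, _, _, .restr i => .restr i

/-- Simultaneous capture-avoiding substitution. -/
def LTerm.subst : {k l : ℕ} → (Fin k → LTerm l) → LTerm k → LTerm l
  | _, _, σ, .var x => σ x
  | _, _, σ, .app t u => .app (t.subst σ) (u.subst σ)
  | _, _, σ, .lam t => .lam (t.subst (Fin.cases (.var 0) (fun x => (σ x).rename Fin.succ)))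
  | _, _, _, .cc => .cc
  | _, _, _, .cont π => .cont π
  | _, _, _, .instr i => .instr i
  | _, _, _, .restr i => .restr i

/-- `t[x := u]` for a term `t` whose only free variable is `x` and a closed term `u`. -/
def LTerm.inst (t : LTerm 1) (u : CTerm) : CTerm := t.subst (fun _ => u)

/-- A term is proof-like if it contains neither a continuation constant nor a restricted
instruction. -/
def LTerm.ProofLike : {k : ℕ} → LTerm k → Prop
  | _, .var _ => True
  | _, .app t u => t.ProofLike ∧ u.ProofLike
  | _, .lam t => t.ProofLike
  | _, .cc => True
  | _, .cont _ => False
  | _, .instr _ => True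
  | _, .restr _ => False

/-- The process `head ⋆ stack`. -/
structure Proc where
  head : CTerm
  stack : Stack

/-- One-step evaluation. -/
inductive Step : Proc → Proc → Prop
  | push (t u : CTerm) (π : Stack) : Step ⟨.app t u, π⟩ ⟨t, .push u π⟩
  | grab (t : LTerm 1) (u : CTerm) (π : Stack) : Step ⟨.lam t, .push u π⟩ ⟨t.inst u, π⟩
  | save (t : CTerm) (π : Stack) : Step ⟨.cc, .push t π⟩ ⟨t, .push (.cont π) π⟩
  | restore (t : CTerm) (π π' : Stack) : Step ⟨.cont π', .push t π⟩ ⟨t, π'⟩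

/-- The evaluation relation: the smallest preorder containing one-step evaluation. -/
def Evaluates : Proc → Proc → Prop := Relation.ReflTransGen Step

/-- A pole: a set of processes closed by anti-evaluation. -/
structure Pole where
  carrier : Set Proc
  closed : ∀ p q : Proc, Evaluates p q → q ∈ carrier → p ∈ carrier

/-- The dual of a set of stacks with respect to a pole. -/
def Pole.dual (P : Pole) (X : Set Stack) : Set CTerm :=
  {t | ∀ π ∈ X, (⟨t, π⟩ : Proc) ∈ P.carrier}

/-! ### The realizability language

De Bruijn representation again. A formula in `Formula k Γ` has its free first-order variables among
`k` variables; `Γ` lists the arities of the propositional variables that may occur free. -/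

/-- First-order terms: every function `ℕ ^ n → ℕ` is a symbol. -/
inductive FOTerm (k : ℕ) : Type
  | var (x : Fin k) : FOTerm k
  | app {n : ℕ} (f : (Fin n → ℕ) → ℕ) (a : Fin n → FOTerm k) : FOTerm k

/-- The value of a first-order term, given values for its variables. -/
def FOTerm.value {k : ℕ} (v : Fin k → ℕ) : FOTerm k → ℕ
  | .var x => v x
  | .app f a => f (fun i => (a i).value v)

/-- The constant `m`. -/
def FOTerm.const {k : ℕ} (m : ℕ) : FOTerm k := .app (n := 0) (fun _ => m) Fin.elim0

/-- Application of a unary function symbol. -/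
def FOTerm.app₁ {k : ℕ} (f : ℕ → ℕ) (a : FOTerm k) : FOTerm k :=
  .app (n := 1) (fun v => f (v 0)) ![a]

/-- Application of a binary function symbol. -/
def FOTerm.app₂ {k : ℕ} (f : ℕ → ℕ → ℕ) (a b : FOTerm k) : FOTerm k :=
  .app (n := 2) (fun v => f (v 0) (v 1)) ![a, b]

/-- `PVar Γ n`: the propositional variables of arity `n` declared in `Γ`. -/
inductive PVar : List ℕ → ℕ → Type
  | zero {Γ : List ℕ} {n : ℕ} : PVar (n :: Γ) n
  | succ {Γ : List ℕ} {m n : ℕ} (X : PVar Γ n) : PVar (m :: Γ) n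

/-- Formulas of the realizability language. -/
inductive Formula : ℕ → List ℕ → Type
  /-- `X(a₁, …, aₙ)` -/
  | pvar {k : ℕ} {Γ : List ℕ} {n : ℕ} (X : PVar Γ n) (a : Fin n → FOTerm k) : Formula k Γ
  | top {k : ℕ} {Γ : List ℕ} : Formula k Γ
  | bot {k : ℕ} {Γ : List ℕ} : Formula k Γ
  | imp {k : ℕ} {Γ : List ℕ} (A B : Formula k Γ) : Formula k Γ
  /-- `∀ x A`; the bound variable has index `0` in `A` -/
  | all₁ {k : ℕ} {Γ : List ℕ} (A : Formula (k + 1) Γ) : Formula k Γ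
  /-- `∀ X A` with `X` of arity `n` -/
  | all₂ {k : ℕ} {Γ : List ℕ} (n : ℕ) (A : Formula k (n :: Γ)) : Formula k Γ
  /-- the equational implication `(a = b) ↦ A` -/
  | eqImp {k : ℕ} {Γ : List ℕ} (a b : FOTerm k) (A : Formula k Γ) : Formula k Γ
  | inter {k : ℕ} {Γ : List ℕ} (A B : Formula k Γ) : Formula k Γ
  | union {k : ℕ} {Γ : List ℕ} (A B : Formula k Γ) : Formula k Γ
  /-- `F(a₁, …, aₙ)` with `F` a function from `ℕ ^ n` to sets of stacks -/
  | param {k : ℕ} {Γ : List ℕ} {n : ℕ} (F : (Fin n → ℕ) → Set Stack) (a : Fin n → FOTerm k) :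
      Formula k Γ

/-- Closed formulas. -/
abbrev CFormula : Type := Formula 0 []

/-- Interpretations of the propositional variables declared in `Γ`. -/
abbrev PEnv (Γ : List ℕ) : Type := (n : ℕ) → PVar Γ n → (Fin n → ℕ) → Set Stack

/-- Extension of an interpretation by a value for the innermost bound propositional variable. -/
def PEnv.cons {Γ : List ℕ} {m : ℕ} (F : (Fin m → ℕ) → Set Stack) (e : PEnv Γ) : PEnv (m :: Γ)
  | _, .zero => F
  | _, .succ X => e _ X

/-- The interpretation of the empty list of propositional variables. -/
def PEnv.nil : PEnv [] := fun _ X => nomatch X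

/-- The falsity value of a formula with respect to a pole, given values for its free variables
(instead of substituting these values into the formula). -/
def Formula.falsity (P : Pole) :
    {k : ℕ} → {Γ : List ℕ} → Formula k Γ → (Fin k → ℕ) → PEnv Γ → Set Stack
  | _, _, .pvar X a, v, e => e _ X (fun i => (a i).value v)
  | _, _, .top, _, _ => ∅
  | _, _, .bot, _, _ => Set.univ
  | _, _, .imp A B, v, e =>
      {ρ | ∃ t ∈ P.dual (A.falsity P v e), ∃ π ∈ B.falsity P v e, ρ = Stack.push t π}
  | _, _, .all₁ A, v, e => ⋃ m : ℕ, A.falsity P (Fin.cons m v) e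
  | _, _, .all₂ n A, v, e => ⋃ F : (Fin n → ℕ) → Set Stack, A.falsity P v (e.cons F)
  | _, _, .eqImp a b A, v, e => {π | a.value v = b.value v ∧ π ∈ A.falsity P v e}
  | _, _, .inter A B, v, e => A.falsity P v e ∪ B.falsity P v e
  | _, _, .union A B, v, e => A.falsity P v e ∩ B.falsity P v e
  | _, _, .param F a, v, _ => F (fun i => (a i).value v)

/-- `t` realizes the closed formula `A` with respect to the pole `P`. -/
def Pole.Realizes (P : Pole) (t : CTerm) (A : CFormula) : Prop :=
  t ∈ P.dual (A.falsity P Fin.elim0 PEnv.nil)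

/-- A realizability structure is a set of poles. -/
abbrev RealizabilityStructure : Type := Set Pole

/-- The theory generated by a realizability structure: the closed formulas which have a proof-like
term that realizes them with respect to all poles of the structure. -/
def RealizabilityStructure.theory (S : RealizabilityStructure) : Set CFormula :=
  {A | ∃ t : CTerm, t.ProofLike ∧ ∀ P ∈ S, P.Realizes t A}

/-- A realizability structure is consistent if its theory does not contain `⊥`. -/
def RealizabilityStructure.Consistent (S : RealizabilityStructure) : Prop :=
  Formula.bot ∉ S.theory

/-! ### Second-order encodings -/

/-- Extension of a renaming of propositional variables under a second-order quantifier. -/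
def PVar.lift {Γ Δ : List ℕ} {m : ℕ} (ρ : (n : ℕ) → PVar Γ n → PVar Δ n) :
    (n : ℕ) → PVar (m :: Γ) n → PVar (m :: Δ) n
  | _, .zero => .zero
  | _, .succ X => .succ (ρ _ X)

/-- Renaming of propositional variables. -/
def Formula.rename : {k : ℕ} → {Γ Δ : List ℕ} → ((n : ℕ) → PVar Γ n → PVar Δ n) →
    Formula k Γ → Formula k Δ
  | _, _, _, ρ, .pvar X a => .pvar (ρ _ X) a
  | _, _, _, _, .top => .top
  | _, _, _, _, .bot => .bot
  | _, _, _, ρ, .imp A B => .imp (A.rename ρ) (B.rename ρ)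
  | _, _, _, ρ, .all₁ A => .all₁ (A.rename ρ)
  | _, _, _, ρ, .all₂ n A => .all₂ n (A.rename (PVar.lift ρ))
  | _, _, _, ρ, .eqImp a b A => .eqImp a b (A.rename ρ)
  | _, _, _, ρ, .inter A B => .inter (A.rename ρ) (B.rename ρ)
  | _, _, _, ρ, .union A B => .union (A.rename ρ) (B.rename ρ)
  | _, _, _, _, .param F a => .param F a

/-- Weakening: `A` seen as a formula in which a new propositional variable may occur. -/
def Formula.wk {k : ℕ} {Γ : List ℕ} {m : ℕ} (A : Formula k Γ) : Formula k (m :: Γ) :=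
  A.rename (fun _ X => .succ X)

/-- `a = b`, that is, `∀ Z, Z(a) → Z(b)`. -/
def Formula.eq {k : ℕ} {Γ : List ℕ} (a b : FOTerm k) : Formula k Γ :=
  .all₂ 1 (.imp (.pvar .zero ![a]) (.pvar .zero ![b]))

/-- `a ≠ b`, that is, `(a = b) ↦ ⊥`. -/
def Formula.ne {k : ℕ} {Γ : List ℕ} (a b : FOTerm k) : Formula k Γ := .eqImp a b .bot

/-- `A ∧ B`, that is, `∀ Z, (A → B → Z) → Z`. -/
def Formula.and {k : ℕ} {Γ : List ℕ} (A B : Formula k Γ) : Formula k Γ :=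
  .all₂ 0 (.imp (.imp A.wk (.imp B.wk (.pvar .zero ![]))) (.pvar .zero ![]))

/-- `A ∨ B`, that is, `∀ Z, (A → Z) → (B → Z) → Z`. -/
def Formula.or {k : ℕ} {Γ : List ℕ} (A B : Formula k Γ) : Formula k Γ :=
  .all₂ 0 (.imp (.imp A.wk (.pvar .zero ![]))
    (.imp (.imp B.wk (.pvar .zero ![])) (.pvar .zero ![])))

/-- The relativized quantifier `∀ x^ℷ2 A`, that is, `∀ x, ℷ2(x) ↦ A`, where `ℷ2(x)` is the equation
`min(x + 1, 2) = x + 1` (which expresses `x + 1 ≤ 2`). -/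
def Formula.allGimel {k : ℕ} {Γ : List ℕ} (A : Formula (k + 1) Γ) : Formula k Γ :=
  .all₁ (.eqImp (.app₂ min (.app₂ (· + ·) (.var 0) (.const 1)) (.const 2))
    (.app₂ (· + ·) (.var 0) (.const 1)) A)

/-! ### The language of Boolean algebras -/

/-- Terms of the language of Boolean algebras. -/
inductive BATerm (k : ℕ) : Type
  | var (x : Fin k) : BATerm k
  | zero : BATerm k
  | one : BATerm k
  | sup (a b : BATerm k) : BATerm k
  | inf (a b : BATerm k) : BATerm k
  | compl (a : BATerm k) : BATerm k

/-- Formulas of the language of Boolean algebras. -/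
inductive BAFormula : ℕ → Type
  | top {k : ℕ} : BAFormula k
  | bot {k : ℕ} : BAFormula k
  | ne {k : ℕ} (a b : BATerm k) : BAFormula k
  | eq {k : ℕ} (a b : BATerm k) : BAFormula k
  | imp {k : ℕ} (A B : BAFormula k) : BAFormula k
  | or {k : ℕ} (A B : BAFormula k) : BAFormula k
  | and {k : ℕ} (A B : BAFormula k) : BAFormula k
  | all {k : ℕ} (A : BAFormula (k + 1)) : BAFormula k

/-- The value of a term in a Boolean algebra. -/
def BATerm.eval {B : Type*} [BooleanAlgebra B] {k : ℕ} (v : Fin k → B) : BATerm k → B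
  | .var x => v x
  | .zero => ⊥
  | .one => ⊤
  | .sup a b => a.eval v ⊔ b.eval v
  | .inf a b => a.eval v ⊓ b.eval v
  | .compl a => (a.eval v)ᶜ

/-- Satisfaction of a formula in a Boolean algebra. -/
def BAFormula.Sat {B : Type*} [BooleanAlgebra B] : {k : ℕ} → BAFormula k → (Fin k → B) → Prop
  | _, .top, _ => True
  | _, .bot, _ => False
  | _, .ne a b, v => a.eval v ≠ b.eval v
  | _, .eq a b, v => a.eval v = b.eval v
  | _, .imp A A', v => A.Sat v → A'.Sat v
  | _, .or A A', v => A.Sat v ∨ A'.Sat v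
  | _, .and A A', v => A.Sat v ∧ A'.Sat v
  | _, .all A, v => ∀ x : B, A.Sat (Fin.cons x v)

/-- The closed formula `A` is true in the Boolean algebra `B`. -/
def BAFormula.TrueIn (B : Type*) [BooleanAlgebra B] (A : BAFormula 0) : Prop :=
  A.Sat (Fin.elim0 : Fin 0 → B)

/-- Translation of the terms into first-order terms of the realizability language: the operations
of the Boolean algebra `{0, 1}` are extended to `ℕ` by treating every positive number as `1`. -/
def BATerm.toFO {k : ℕ} : BATerm k → FOTerm k
  | .var x => .var x
  | .zero => .const 0
  | .one => .const 1
  | .sup a b => .app₂ (fun m n => if 0 < m ∨ 0 < n then 1 else 0) a.toFO b.toFO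
  | .inf a b => .app₂ (fun m n => if 0 < m ∧ 0 < n then 1 else 0) a.toFO b.toFO
  | .compl a => .app₁ (fun m => if m = 0 then 1 else 0) a.toFO

/-- `ℷ2 ⊨ A`: the formula `A` with all its quantifiers relativized to `ℷ2`. -/
def BAFormula.gimel : {k : ℕ} → BAFormula k → Formula k []
  | _, .top => .top
  | _, .bot => .bot
  | _, .ne a b => .ne a.toFO b.toFO
  | _, .eq a b => .eq a.toFO b.toFO
  | _, .imp A A' => .imp A.gimel A'.gimel
  | _, .or A A' => .or A.gimel A'.gimel
  | _, .and A A' => .and A.gimel A'.gimel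
  | _, .all A => .allGimel A.gimel

/-- Finite (left-associative) disjunctions; the empty one is `⊥`. -/
def BAFormula.bigOr {k : ℕ} : List (BAFormula k) → BAFormula k
  | [] => .bot
  | A :: l => l.foldl .or A

/-- Universal closure. -/
def BAFormula.close : {k : ℕ} → BAFormula k → BAFormula 0
  | 0, A => A
  | _ + 1, A => A.all.close

/-- The formula `∀ x₁ … xₙ, ⋁_{i ≠ j} xᵢ = xⱼ`, which says that there are fewer than `n`
elements. -/
def BAFormula.fewerThan (n : ℕ) : BAFormula 0 :=
  BAFormula.close (k := n) <| .bigOr <|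
    ((List.finRange n ×ˢ List.finRange n).filter (fun p => p.1 ≠ p.2)).map
      (fun p => .eq (.var p.1) (.var p.2))

/-- `|ℷ2| < n` -/
def gimelLT (n : ℕ) : CFormula := (BAFormula.fewerThan n).gimel

/-- `|ℷ2| ≤ n` -/
def gimelLE (n : ℕ) : CFormula := gimelLT (n + 1)

/-- `|ℷ2| ≥ n` -/
def gimelGE (n : ℕ) : CFormula := .imp (gimelLT n) .bot

/-- `|ℷ2| = n` -/
def gimelEq (n : ℕ) : CFormula := .and (gimelGE n) (gimelLT (n + 1))

end ClassicalRealizability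

open ClassicalRealizability

/-!
The structure consists of `n` poles, one for each `i : Fin n`, and the elements of the Boolean
algebra `Set (Fin n)` are read coordinatewise: in the `i`-th pole, the set `s` is represented by the
number `1` if `i ∈ s` and by `0` otherwise. The poles are generated by anti-evaluation together with
rules for two families of nonrestricted instructions indexed by `j : Fin n`:

* `atom j` realizes `⊥` in all poles except the `j`-th one. It serves as a witness that two elements
  of `Set (Fin n)` differ at the coordinate `j`.
* `fork j`, applied to two arguments, needs both of them to succeed, except in the `j`-th pole,
  where one of them is enough. Nesting the forks for all `j` turns a family of terms indexed by
  `Set (Fin n)` into one term (`exists_term_of_forall_set`). In the `i`-th pole this term succeeds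
  wherever all the terms indexed by sets containing `i` succeed, and also wherever all those
  indexed by sets not containing `i` do. This is what realizes a universal quantifier over `ℷ2`,
  whose falsity value is the union of those for `0` and `1`.

By induction on a formula `A` of the language of Boolean algebras, and for all values of its
variables in `Set (Fin n)`, some proof-like term realizes, in all poles at once, the formula
`ℷ2 ⊨ A` if `A` is true and its negation otherwise (`exists_decides`). On the other hand no process
belongs to all the poles (`exists_not_accept`): if all poles accept `fork j` on two arguments, then
the argument that succeeds in the `j`-th pole is accepted by all poles. So the structure is
consistent, and its theory contains `ℷ2 ⊨ A` exactly when `A` holds in `Set (Fin n)`, hence in any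
Boolean algebra with `2 ^ n` elements. The statements on cardinality are instances of this.
-/

namespace ClassicalRealizability

/-! ### Closed terms under abstractions -/

/-- A closed term seen as a term with free variables among `k` variables. -/
def LTerm.wk {k : ℕ} (t : CTerm) : LTerm k := t.rename Fin.elim0

/-- Substituting into a renamed term is a renaming if it sends the variables that occur to
variables. -/
theorem LTerm.subst_rename_of_var : {k l m : ℕ} → (t : LTerm k) → (ρ : Fin k → Fin l) →
    (σ : Fin l → LTerm m) → (τ : Fin k → Fin m) → (∀ x, σ (ρ x) = .var (τ x)) →
    (t.rename ρ).subst σ = t.rename τ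
  | _, _, _, .var x, _, _, _, h => h x
  | _, _, _, .app t u, ρ, σ, τ, h => by
      simp [rename, subst, subst_rename_of_var t ρ σ τ h, subst_rename_of_var u ρ σ τ h]
  | _, _, _, .lam t, ρ, σ, τ, h => by
      simp only [rename, subst]
      rw [subst_rename_of_var t]
      refine Fin.cases rfl (fun x => ?_)
      simp [h, rename]
  | _, _, _, .cc, _, _, _, _ => rfl
  | _, _, _, .cont _, _, _, _, _ => rfl
  | _, _, _, .instr _, _, _, _, _ => rfl
  | _, _, _, .restr _, _, _, _, _ => rfl

theorem LTerm.rename_id : {k : ℕ} → (t : LTerm k) → (ρ : Fin k → Fin k) → (∀ x, ρ x = x) →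
    t.rename ρ = t
  | _, .var x, _, h => by simp [rename, h]
  | _, .app t u, ρ, h => by simp [rename, rename_id t ρ h, rename_id u ρ h]
  | _, .lam t, ρ, h => by
      simp only [rename]
      rw [rename_id t]
      exact Fin.cases rfl (fun x => by simp [h])
  | _, .cc, _, _ => rfl
  | _, .cont _, _, _ => rfl
  | _, .instr _, _, _ => rfl
  | _, .restr _, _, _ => rfl

theorem LTerm.ProofLike.rename : {k l : ℕ} → {t : LTerm k} → (ρ : Fin k → Fin l) →
    t.ProofLike → (t.rename ρ).ProofLike
  | _, _, .var _, _, _ => trivial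
  | _, _, .app _ _, ρ, h => ⟨h.1.rename ρ, h.2.rename ρ⟩
  | _, _, .lam t, _, h => LTerm.ProofLike.rename (t := t) _ h
  | _, _, .cc, _, _ => trivial
  | _, _, .instr _, _, _ => trivial

theorem LTerm.ProofLike.wk {k : ℕ} {t : CTerm} (h : t.ProofLike) :
    (LTerm.wk t : LTerm k).ProofLike := h.rename _

@[simp] theorem LTerm.wk_zero (t : CTerm) : (LTerm.wk t : CTerm) = t :=
  rename_id t _ (fun x => x.elim0)

@[simp] theorem LTerm.wk_subst {k l : ℕ} (t : CTerm) (σ : Fin k → LTerm l) :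
    (LTerm.wk t : LTerm k).subst σ = LTerm.wk t :=
  subst_rename_of_var t _ _ _ (fun x => x.elim0)

@[simp] theorem LTerm.rename_eq_wk {k : ℕ} (t : CTerm) (ρ : Fin 0 → Fin k) :
    t.rename ρ = LTerm.wk t := by
  rw [LTerm.wk, Subsingleton.elim ρ Fin.elim0]

/-! ### The poles -/

/-- The instruction that realizes `⊥` in all poles but the `j`-th one. -/
def atom {n : ℕ} (j : Fin n) : CTerm := .instr (2 * j)

/-- The instruction that needs both its arguments to succeed, except in the `j`-th pole, where one
of them is enough. -/
def fork {n : ℕ} (j : Fin n) : CTerm := .instr (2 * j + 1)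

/-- The processes of the `i`-th pole. -/
inductive Accept {n : ℕ} (i : Fin n) : Proc → Prop
  | atom (j : Fin n) (hj : j ≠ i) (π : Stack) : Accept i ⟨atom j, π⟩
  | forkLeft (j : Fin n) (u v : CTerm) (π : Stack) (hu : Accept i ⟨u, π⟩)
      (hv : j ≠ i → Accept i ⟨v, π⟩) : Accept i ⟨fork j, .push u (.push v π)⟩
  | forkRight (j : Fin n) (u v : CTerm) (π : Stack) (hu : j ≠ i → Accept i ⟨u, π⟩)
      (hv : Accept i ⟨v, π⟩) : Accept i ⟨fork j, .push u (.push v π)⟩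
  | step (p q : Proc) (hpq : Step p q) (hq : Accept i q) : Accept i p

/-- The `i`-th pole. -/
def coordPole {n : ℕ} (i : Fin n) : Pole where
  carrier := {p | Accept i p}
  closed p q hpq hq := by
    induction hpq using Relation.ReflTransGen.head_induction_on with
    | refl => exact hq
    | head h _ ih => exact Accept.step _ _ h ih

theorem Step.deterministic {p q q' : Proc} (h : Step p q) (h' : Step p q') : q = q' := by
  cases h <;> cases h' <;> rfl

theorem not_accept_atom {n : ℕ} {j : Fin n} {π : Stack} : ¬ Accept j ⟨atom j, π⟩ := by
  intro h
  generalize hp : (⟨atom j, π⟩ : Proc) = p at h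
  cases h with
  | atom j' hj =>
    simp only [atom, Proc.mk.injEq, LTerm.instr.injEq] at hp
    exact hj (Fin.ext (by omega))
  | forkLeft | forkRight =>
    simp only [atom, fork, Proc.mk.injEq, LTerm.instr.injEq] at hp
    omega
  | step _ q hpq => subst hp; cases hpq

theorem accept_fork_iff {n : ℕ} {i j : Fin n} {u v : CTerm} {π : Stack} :
    Accept i ⟨fork j, .push u (.push v π)⟩ ↔
      (Accept i ⟨u, π⟩ ∨ Accept i ⟨v, π⟩) ∧
        (j ≠ i → Accept i ⟨u, π⟩ ∧ Accept i ⟨v, π⟩) := by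
  constructor
  · intro h
    generalize hp : (⟨fork j, .push u (.push v π)⟩ : Proc) = p at h
    cases h with
    | atom j' hj =>
      simp only [atom, fork, Proc.mk.injEq, LTerm.instr.injEq] at hp
      omega
    | forkLeft j' u' v' π' hu hv =>
      simp only [fork, Proc.mk.injEq, LTerm.instr.injEq, Stack.push.injEq] at hp
      obtain ⟨hj, rfl, rfl, rfl⟩ := hp
      obtain rfl : j = j' := Fin.ext (by omega)
      exact ⟨.inl hu, fun h => ⟨hu, hv h⟩⟩
    | forkRight j' u' v' π' hu hv =>
      simp only [fork, Proc.mk.injEq, LTerm.instr.injEq, Stack.push.injEq] at hp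
      obtain ⟨hj, rfl, rfl, rfl⟩ := hp
      obtain rfl : j = j' := Fin.ext (by omega)
      exact ⟨.inr hv, fun h => ⟨hu h, hv⟩⟩
    | step _ q hpq => subst hp; cases hpq
  · rintro ⟨hu | hv, h⟩
    · exact .forkLeft _ _ _ _ hu (fun hj => (h hj).2)
    · exact .forkRight _ _ _ _ (fun hj => (h hj).1) hv

theorem accept_iff_of_step {n : ℕ} {i : Fin n} {p q : Proc} (hpq : Step p q) :
    Accept i p ↔ Accept i q := by
  refine ⟨fun h => ?_, .step p q hpq⟩
  cases h with
  | atom | forkLeft | forkRight => cases hpq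
  | step _ q' hpq' hq' => exact hpq.deterministic hpq' ▸ hq'

/-- No process belongs to all the poles. -/
theorem exists_not_accept {n : ℕ} (hn : 0 < n) (p : Proc) : ∃ i : Fin n, ¬ Accept i p := by
  by_contra! hall
  induction hall ⟨0, hn⟩ with
  | atom j hj π => exact not_accept_atom (hall j)
  | forkLeft j u v π hu hv ihu ihv =>
    have hfork i := accept_fork_iff.1 (hall i)
    rcases (hfork j).1 with h | h
    · exact ihu fun i => (eq_or_ne j i).elim (fun e => e ▸ h) (fun e => ((hfork i).2 e).1)
    · have hv' i : Accept i ⟨v, π⟩ :=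
        (eq_or_ne j i).elim (fun e => e ▸ h) (fun e => ((hfork i).2 e).2)
      by_cases hj : j = ⟨0, hn⟩
      · -- Here only `u` has a smaller derivation in the pole of the induction,
        -- and `u` is accepted by this pole and by all the others.
        exact ihu fun i => (eq_or_ne j i).elim (fun e => e ▸ hj ▸ hu)
          (fun e => ((hfork i).2 e).1)
      · exact ihv hj hv'
  | forkRight j u v π hu hv ihu ihv =>
    have hfork i := accept_fork_iff.1 (hall i)
    rcases (hfork j).1 with h | h
    · by_cases hj : j = ⟨0, hn⟩
      · exact ihv fun i => (eq_or_ne j i).elim (fun e => e ▸ hj ▸ hv)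
          (fun e => ((hfork i).2 e).2)
      · exact ihu hj fun i =>
          (eq_or_ne j i).elim (fun e => e ▸ h) (fun e => ((hfork i).2 e).1)
    · exact ihv fun i => (eq_or_ne j i).elim (fun e => e ▸ h) (fun e => ((hfork i).2 e).2)
  | step p q hpq hq ih => exact ih fun i => (accept_iff_of_step hpq).1 (hall i)

/-- The realizability structure formed by the `n` poles. -/
def coordStructure (n : ℕ) : RealizabilityStructure := Set.range (coordPole (n := n))

theorem coordStructure_consistent {n : ℕ} (hn : 0 < n) : (coordStructure n).Consistent := by
  rintro ⟨t, -, ht⟩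
  obtain ⟨i, hi⟩ := exists_not_accept hn ⟨t, .bottom 0⟩
  exact hi (ht _ ⟨i, rfl⟩ _ (Set.mem_univ _))

theorem Accept.push {n : ℕ} {i : Fin n} {t u : CTerm} {π : Stack}
    (h : Accept i ⟨t, .push u π⟩) : Accept i ⟨.app t u, π⟩ :=
  .step _ _ (.push t u π) h

theorem Accept.grab {n : ℕ} {i : Fin n} {t : LTerm 1} {u : CTerm} {π : Stack}
    (h : Accept i ⟨t.inst u, π⟩) : Accept i ⟨.lam t, .push u π⟩ :=
  .step _ _ (.grab t u π) h

/-- A single term `w` that the `i`-th pole accepts on every stack on which it accepts all the terms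
`t s` with `i ∈ s`, and on every stack on which it accepts all the terms `t s` with `i ∉ s`. It is
obtained by nesting the forks for all coordinates above the terms `t s`. -/
theorem exists_term_of_forall_set {n : ℕ} (t : Set (Fin n) → CTerm) (ht : ∀ s, (t s).ProofLike) :
    ∃ w : CTerm, w.ProofLike ∧ ∀ (i : Fin n) (b : Prop) (π : Stack),
      (∀ s, (i ∈ s ↔ b) → Accept i ⟨t s, π⟩) → Accept i ⟨w, π⟩ := by
  classical
  -- The forks for the coordinates in `D` are in place; `s` lists the choices at the others.
  have key : ∀ (D : Finset (Fin n)) (s : Set (Fin n)), ∃ w : CTerm, w.ProofLike ∧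
      ∀ (i : Fin n) (b : Prop) (π : Stack), (i ∉ D → (i ∈ s ↔ b)) →
        (∀ s, (i ∈ s ↔ b) → Accept i ⟨t s, π⟩) → Accept i ⟨w, π⟩ := by
    intro D
    induction D using Finset.induction_on with
    | empty => exact fun s => ⟨t s, ht s, fun i b π hb h => h s (hb (by simp))⟩
    | insert j D _ ih =>
      intro s
      obtain ⟨u, hu, hu'⟩ := ih (insert j s)
      obtain ⟨v, hv, hv'⟩ := ih (s \ {j})
      refine ⟨.app (.app (fork j) u) v, ⟨⟨trivial, hu⟩, hv⟩, fun i b π hb h => ?_⟩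
      refine .push (.push (accept_fork_iff.2 ⟨?_, fun hji => ⟨hu' i b π (fun hi => ?_) h,
        hv' i b π (fun hi => ?_) h⟩⟩))
      · by_cases hji : i = j
        · subst hji
          by_cases hb' : b
          · exact .inl (hu' i b π (fun _ => by simp [hb']) h)
          · exact .inr (hv' i b π (fun _ => by simp [hb']) h)
        · refine .inl (hu' i b π (fun hi => ?_) h)
          simpa [hji] using hb (by simp [hji, hi])
      · simpa [hji.symm] using hb (by simp [hji.symm, hi])
      · simpa [hji.symm] using hb (by simp [hji.symm, hi])
  obtain ⟨w, hw, hw'⟩ := key Finset.univ ∅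
  exact ⟨w, hw, fun i b π h => hw' i b π (by simp) h⟩

/-! ### Deciding the formulas of the language of Boolean algebras -/

theorem Formula.falsity_rename (P : Pole) {k : ℕ} {Γ : List ℕ} (A : Formula k Γ) :
    ∀ {Δ : List ℕ} (ρ : (n : ℕ) → PVar Γ n → PVar Δ n) (v : Fin k → ℕ) (e : PEnv Δ),
      (A.rename ρ).falsity P v e = A.falsity P v (fun n X => e n (ρ n X)) := by
  induction A with
  | pvar | top | bot | param => intros; rfl
  | imp A B ihA ihB => intros; simp only [rename, falsity, ihA, ihB]
  | all₁ A ih => intros; simp only [rename, falsity, ih]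
  | all₂ m A ih =>
    intro Δ ρ v e
    simp only [rename, falsity, ih]
    refine Set.iUnion_congr fun F => ?_
    congr 1
    funext n X
    cases X <;> rfl
  | eqImp a b A ih => intros; simp only [rename, falsity, ih]
  | inter A B ihA ihB => intros; simp only [rename, falsity, ihA, ihB]
  | union A B ihA ihB => intros; simp only [rename, falsity, ihA, ihB]

theorem Formula.falsity_wk (P : Pole) {k m : ℕ} {Γ : List ℕ} (A : Formula k Γ) (v : Fin k → ℕ)
    (F : (Fin m → ℕ) → Set Stack) (e : PEnv Γ) :
    A.wk.falsity P v (e.cons F) = A.falsity P v e :=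
  A.falsity_rename P _ v _

open Classical in
/-- The numbers that represent given elements of `Set (Fin n)` in the `i`-th pole. -/
noncomputable def coord {n k : ℕ} (i : Fin n) (v : Fin k → Set (Fin n)) : Fin k → ℕ :=
  fun x => if i ∈ v x then 1 else 0

open Classical in
theorem value_toFO {n k : ℕ} (i : Fin n) (v : Fin k → Set (Fin n)) (a : BATerm k) :
    a.toFO.value (coord i v) = if i ∈ a.eval v then 1 else 0 := by
  induction a with
  | var x => rfl
  | zero => simp [BATerm.toFO, BATerm.eval, FOTerm.const, FOTerm.value]
  | one => simp [BATerm.toFO, BATerm.eval, FOTerm.const, FOTerm.value]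
  | sup a b iha ihb =>
    simp only [BATerm.toFO, BATerm.eval, FOTerm.app₂, FOTerm.value, Matrix.cons_val_zero,
      Matrix.cons_val_one, iha, ihb]
    by_cases ha : i ∈ a.eval v <;> by_cases hb : i ∈ b.eval v <;> simp [ha, hb]
  | inf a b iha ihb =>
    simp only [BATerm.toFO, BATerm.eval, FOTerm.app₂, FOTerm.value, Matrix.cons_val_zero,
      Matrix.cons_val_one, iha, ihb]
    by_cases ha : i ∈ a.eval v <;> by_cases hb : i ∈ b.eval v <;> simp [ha, hb]
  | compl a ih =>
    simp only [BATerm.toFO, BATerm.eval, FOTerm.app₁, FOTerm.value, Matrix.cons_val_zero, ih]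
    by_cases ha : i ∈ a.eval v <;> simp [ha]

theorem value_toFO_eq_iff {n k : ℕ} (i : Fin n) (v : Fin k → Set (Fin n)) (a b : BATerm k) :
    a.toFO.value (coord i v) = b.toFO.value (coord i v) ↔ (i ∈ a.eval v ↔ i ∈ b.eval v) := by
  rw [value_toFO, value_toFO]
  by_cases ha : i ∈ a.eval v <;> by_cases hb : i ∈ b.eval v <;> simp [ha, hb]

/-- The term `t` realizes `A` in all poles, the values `v` in `Set (Fin n)` of its variables being
read coordinatewise. -/
def Forces {n k : ℕ} (t : CTerm) (A : Formula k []) (v : Fin k → Set (Fin n)) : Prop :=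
  ∀ i, ∀ π ∈ A.falsity (coordPole i) (coord i v) PEnv.nil, Accept i ⟨t, π⟩

/-- The universal quantifier over `ℷ2` is realized from realizers of all the instances. -/
theorem exists_forces_allGimel {n k : ℕ} {A : Formula (k + 1) []} {v : Fin k → Set (Fin n)}
    {t : Set (Fin n) → CTerm} (ht : ∀ s, (t s).ProofLike)
    (h : ∀ s, Forces (t s) A (Fin.cons s v : Fin (k + 1) → Set (Fin n))) :
    ∃ w : CTerm, w.ProofLike ∧ Forces w A.allGimel v := by
  obtain ⟨w, hw, hw'⟩ := exists_term_of_forall_set t ht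
  refine ⟨w, hw, fun i π hπ => ?_⟩
  obtain ⟨m, hm, hπ⟩ := Set.mem_iUnion.1 hπ
  have hm : min (m + 1) 2 = m + 1 := hm
  refine hw' i (m = 1) π fun s hs => h s i π ?_
  convert hπ using 1
  congr 1
  funext x
  refine Fin.cases ?_ (fun x => rfl) x
  simp only [coord, Fin.cons_zero, hs]
  split_ifs <;> omega

/-- A realizer of a universally quantified formula realizes, in the `i`-th pole, its instance at
the `i`-th coordinate of any `s`. -/
theorem mem_dual_of_allGimel {n k : ℕ} {A : Formula (k + 1) []} {v : Fin k → Set (Fin n)}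
    {i : Fin n} {t : CTerm} (s : Set (Fin n))
    (h : t ∈ (coordPole i).dual (A.allGimel.falsity (coordPole i) (coord i v) PEnv.nil)) :
    t ∈ (coordPole i).dual (A.falsity (coordPole i)
      (coord i (Fin.cons s v : Fin (k + 1) → Set (Fin n))) PEnv.nil) := by
  intro π hπ
  refine h π (Set.mem_iUnion.2 ⟨coord i (Fin.cons s v : Fin (k + 1) → Set (Fin n)) 0, ?_, ?_⟩)
  · change min (_ + 1) 2 = _ + 1
    simp only [coord]
    split_ifs <;> rfl
  · convert hπ using 1
    congr 1
    funext x
    exact Fin.cases rfl (fun x => rfl) x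

/-- The identity `λx.x`. -/
def idTerm : CTerm := .lam (.var 0)

theorem accept_id {n : ℕ} {i : Fin n} {u : CTerm} {π : Stack} (h : Accept i ⟨u, π⟩) :
    Accept i ⟨idTerm, .push u π⟩ := .grab h

/-- Every formula is decided in the structure according to its truth value in `Set (Fin n)`. -/
theorem exists_decides {n k : ℕ} (A : BAFormula k) (v : Fin k → Set (Fin n)) :
    ∃ t : CTerm, t.ProofLike ∧
      (A.Sat v ∧ Forces t A.gimel v ∨ ¬ A.Sat v ∧ Forces t (A.gimel.imp .bot) v) := by
  induction A with
  | top => exact ⟨idTerm, trivial, .inl ⟨trivial, fun i π hπ => hπ.elim⟩⟩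
  | bot =>
    refine ⟨idTerm, trivial, .inr ⟨id, ?_⟩⟩
    rintro i _ ⟨u, hu, π, hπ, rfl⟩
    exact accept_id (hu π hπ)
  | ne a b =>
    by_cases h : a.eval v = b.eval v
    · refine ⟨idTerm, trivial, .inr ⟨fun h' => h' h, ?_⟩⟩
      rintro i _ ⟨u, hu, π, hπ, rfl⟩
      exact accept_id (hu π ⟨(value_toFO_eq_iff i v a b).2 (by rw [h]), hπ⟩)
    · obtain ⟨j, hj⟩ : ∃ j, ¬ (j ∈ a.eval v ↔ j ∈ b.eval v) := by
        by_contra! h'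
        exact h (Set.ext h')
      refine ⟨atom j, trivial, .inl ⟨h, ?_⟩⟩
      rintro i π ⟨hi, -⟩
      exact .atom j (by rintro rfl; exact hj ((value_toFO_eq_iff j v a b).1 hi)) π
  | eq a b =>
    by_cases h : a.eval v = b.eval v
    · refine ⟨idTerm, trivial, .inl ⟨h, ?_⟩⟩
      intro i ρ hρ
      obtain ⟨F, u, hu, π, hπ, rfl⟩ := Set.mem_iUnion.1 hρ
      refine accept_id (hu π ?_)
      simpa [Formula.falsity, PEnv.cons, (value_toFO_eq_iff i v a b).2 (by rw [h])] using hπ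
    · obtain ⟨j, hj⟩ : ∃ j, ¬ (j ∈ a.eval v ↔ j ∈ b.eval v) := by
        by_contra! h'
        exact h (Set.ext h')
      refine ⟨.lam (.app (.var 0) (LTerm.wk (atom j))), ⟨trivial, trivial⟩, .inr ⟨h, ?_⟩⟩
      rintro i _ ⟨u, hu, π, -, rfl⟩
      refine .grab ?_
      simp only [LTerm.inst, LTerm.subst, LTerm.wk_subst, LTerm.wk_zero]
      -- Instantiate `Z` by a predicate that holds at no number but the value of `b`: the premise
      -- `Z(a)` is then trivial in the `j`-th pole.
      refine .push (hu _ (Set.mem_iUnion.2 ⟨fun x => {ρ | ρ = π ∧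
        (x 0 = b.toFO.value (coord i v))}, atom j, ?_, π, ⟨rfl, rfl⟩, rfl⟩))
      rintro ρ ⟨-, hi⟩
      exact .atom j (by rintro rfl; exact hj ((value_toFO_eq_iff j v a b).1 hi)) ρ
  | imp A B ihA ihB =>
    obtain ⟨t, ht, hA⟩ := ihA v
    obtain ⟨u, hu, hB⟩ := ihB v
    rcases hA with ⟨hA, htA⟩ | ⟨hA, htA⟩
    · rcases hB with ⟨hB, huB⟩ | ⟨hB, huB⟩
      · refine ⟨.lam (LTerm.wk u), hu.wk, .inl ⟨fun _ => hB, ?_⟩⟩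
        rintro i _ ⟨w, hw, π, hπ, rfl⟩
        refine .grab ?_
        simpa only [LTerm.inst, LTerm.wk_subst, LTerm.wk_zero] using huB i π hπ
      · refine ⟨.lam (.app (LTerm.wk u) (.app (.var 0) (LTerm.wk t))),
          ⟨hu.wk, trivial, ht.wk⟩, .inr ⟨fun h => hB (h hA), ?_⟩⟩
        rintro i _ ⟨w, hw, π, hπ, rfl⟩
        refine .grab ?_
        simp only [LTerm.inst, LTerm.subst, LTerm.wk_subst, LTerm.wk_zero]
        exact .push (huB i _ ⟨_, fun ρ hρ => .push (hw _ ⟨t, htA i, ρ, hρ, rfl⟩), π, hπ, rfl⟩)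
    · refine ⟨t, ht, .inl ⟨fun h => (hA h).elim, ?_⟩⟩
      rintro i _ ⟨w, hw, π, hπ, rfl⟩
      exact htA i _ ⟨w, hw, π, trivial, rfl⟩
  | or A B ihA ihB =>
    obtain ⟨t, ht, hA⟩ := ihA v
    obtain ⟨u, hu, hB⟩ := ihB v
    rcases hA with ⟨hA, htA⟩ | ⟨hA, htA⟩
    · refine ⟨.lam (.lam (.app (.var 1) (LTerm.wk t))), ⟨trivial, ht.wk⟩, .inl ⟨.inl hA, ?_⟩⟩
      intro i ρ hρ
      obtain ⟨F, x, hx, _, ⟨y, hy, π, hπ, rfl⟩, rfl⟩ := Set.mem_iUnion.1 hρ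
      refine .grab (.grab ?_)
      -- The first argument has been weakened to pass under the second abstraction.
      change Accept i ⟨.app ((LTerm.rename Fin.succ x).inst y)
        (((LTerm.wk t : LTerm 2).subst _).inst y), π⟩
      simp only [LTerm.rename_eq_wk, LTerm.inst, LTerm.wk_subst, LTerm.wk_zero]
      refine .push (hx _ ⟨t, ?_, π, hπ, rfl⟩)
      rw [Formula.falsity_wk]
      exact htA i
    · rcases hB with ⟨hB, huB⟩ | ⟨hB, huB⟩
      · refine ⟨.lam (.lam (.app (.var 0) (LTerm.wk u))), ⟨trivial, hu.wk⟩, .inl ⟨.inr hB, ?_⟩⟩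
        intro i ρ hρ
        obtain ⟨F, x, hx, _, ⟨y, hy, π, hπ, rfl⟩, rfl⟩ := Set.mem_iUnion.1 hρ
        refine .grab (.grab ?_)
        change Accept i ⟨.app y (((LTerm.wk u : LTerm 2).subst _).inst y), π⟩
        simp only [LTerm.inst, LTerm.wk_subst, LTerm.wk_zero]
        refine .push (hy _ ⟨u, ?_, π, hπ, rfl⟩)
        rw [Formula.falsity_wk]
        exact huB i
      · refine ⟨.lam (.app (.app (.var 0) (LTerm.wk t)) (LTerm.wk u)),
          ⟨⟨trivial, ht.wk⟩, hu.wk⟩, .inr ⟨not_or.2 ⟨hA, hB⟩, ?_⟩⟩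
        rintro i _ ⟨w, hw, π, hπ, rfl⟩
        refine .grab ?_
        simp only [LTerm.inst, LTerm.subst, LTerm.wk_subst, LTerm.wk_zero]
        refine .push (.push (hw _ (Set.mem_iUnion.2 ⟨fun _ => Set.univ, t, ?_, _,
          ⟨u, ?_, π, trivial, rfl⟩, rfl⟩)))
        all_goals
          simp only [Formula.falsity, Formula.falsity_wk]
        · exact htA i
        · exact huB i
  | and A B ihA ihB =>
    obtain ⟨t, ht, hA⟩ := ihA v
    obtain ⟨u, hu, hB⟩ := ihB v
    rcases hA with ⟨hA, htA⟩ | ⟨hA, htA⟩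
    · rcases hB with ⟨hB, huB⟩ | ⟨hB, huB⟩
      · refine ⟨.lam (.app (.app (.var 0) (LTerm.wk t)) (LTerm.wk u)),
          ⟨⟨trivial, ht.wk⟩, hu.wk⟩, .inl ⟨⟨hA, hB⟩, ?_⟩⟩
        intro i ρ hρ
        obtain ⟨F, x, hx, π, hπ, rfl⟩ := Set.mem_iUnion.1 hρ
        refine .grab ?_
        simp only [LTerm.inst, LTerm.subst, LTerm.wk_subst, LTerm.wk_zero]
        refine .push (.push (hx _ ⟨t, ?_, _, ⟨u, ?_, π, hπ, rfl⟩, rfl⟩))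
        all_goals rw [Formula.falsity_wk]
        · exact htA i
        · exact huB i
      · refine ⟨.lam (.app (.var 0) (.lam (LTerm.wk u))), ⟨trivial, hu.wk⟩,
          .inr ⟨fun h => hB h.2, ?_⟩⟩
        rintro i _ ⟨w, hw, π, hπ, rfl⟩
        refine .grab ?_
        simp only [LTerm.inst, LTerm.subst, LTerm.wk_subst]
        refine .push (hw _ (Set.mem_iUnion.2 ⟨fun _ => Set.univ, _, ?_, π, trivial, rfl⟩))
        rintro _ ⟨x, hx, _, ⟨y, hy, ρ, hρ, rfl⟩, rfl⟩
        refine .grab ?_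
        simp only [LTerm.inst, LTerm.wk_subst, LTerm.wk_zero]
        rw [Formula.falsity_wk] at hy
        exact huB i _ ⟨y, hy, ρ, trivial, rfl⟩
    · refine ⟨.lam (.app (.var 0) (.lam (.lam (.app (LTerm.wk t) (.var 1))))),
        ⟨trivial, ht.wk, trivial⟩, .inr ⟨fun h => hA h.1, ?_⟩⟩
      rintro i _ ⟨w, hw, π, hπ, rfl⟩
      refine .grab ?_
      refine .push (hw _ (Set.mem_iUnion.2 ⟨fun _ => Set.univ, _, ?_, π, trivial, rfl⟩))
      rintro _ ⟨x, hx, _, ⟨y, hy, ρ, hρ, rfl⟩, rfl⟩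
      refine .grab (.grab ?_)
      change Accept i ⟨.app ((((LTerm.wk t : LTerm 3).subst _).subst _).inst y)
        ((LTerm.rename Fin.succ x).inst y), ρ⟩
      simp only [LTerm.rename_eq_wk, LTerm.inst, LTerm.wk_subst, LTerm.wk_zero]
      rw [Formula.falsity_wk] at hx
      exact .push (htA i _ ⟨x, hx, ρ, trivial, rfl⟩)
  | all A ih =>
    by_cases h : ∀ s, A.Sat (Fin.cons s v : Fin _ → Set (Fin n))
    · choose t ht hA using fun s => ih (Fin.cons s v : Fin _ → Set (Fin n))
      obtain ⟨w, hw, hw'⟩ := exists_forces_allGimel ht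
        (fun s => (hA s).elim (fun h => h.2) (fun h' => (h'.1 (h s)).elim))
      exact ⟨w, hw, .inl ⟨h, hw'⟩⟩
    · obtain ⟨s, hs⟩ := not_forall.1 h
      obtain ⟨t, ht, hA⟩ := ih (Fin.cons s v : Fin _ → Set (Fin n))
      refine ⟨t, ht, .inr ⟨h, ?_⟩⟩
      rintro i _ ⟨w, hw, π, hπ, rfl⟩
      exact (hA.resolve_left fun h => hs h.1).2 i _ ⟨w, mem_dual_of_allGimel s hw, π, trivial, rfl⟩

theorem Forces.realizes {n : ℕ} {t : CTerm} {A : CFormula}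
    (h : Forces t A (Fin.elim0 : Fin 0 → Set (Fin n))) {P : Pole} (hP : P ∈ coordStructure n) :
    P.Realizes t A := by
  obtain ⟨i, rfl⟩ := hP
  intro π hπ
  refine h i π ?_
  rwa [Subsingleton.elim (coord i Fin.elim0) Fin.elim0]

theorem gimel_mem_theory_iff {n : ℕ} (hn : 0 < n) (A : BAFormula 0) :
    A.gimel ∈ (coordStructure n).theory ↔ A.TrueIn (Set (Fin n)) := by
  obtain ⟨t, ht, ⟨hA, h⟩ | ⟨hA, h⟩⟩ := exists_decides A (Fin.elim0 : Fin 0 → Set (Fin n))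
  · exact iff_of_true ⟨t, ht, fun P hP => h.realizes hP⟩ hA
  · refine iff_of_false ?_ hA
    rintro ⟨u, hu, hu'⟩
    refine coordStructure_consistent hn ⟨.app t u, ⟨ht, hu⟩, fun P hP π hπ => ?_⟩
    exact P.closed _ _ (.single (.push t u π)) (h.realizes hP _ ⟨u, hu' P hP, π, hπ, rfl⟩)

/-! ### Finite Boolean algebras -/

theorem BATerm.map_eval {B C : Type*} [BooleanAlgebra B] [BooleanAlgebra C] (f : B ≃o C) {k : ℕ}
    (v : Fin k → B) (a : BATerm k) : f (a.eval v) = a.eval (f ∘ v) := by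
  induction a with
  | var x => rfl
  | zero => exact map_bot f
  | one => exact map_top f
  | sup a b iha ihb => simp only [eval, map_sup, iha, ihb]
  | inf a b iha ihb => simp only [eval, map_inf, iha, ihb]
  | compl a ih => simp only [eval, map_compl', ih]

theorem BAFormula.sat_comp_orderIso {B C : Type*} [BooleanAlgebra B] [BooleanAlgebra C]
    (f : B ≃o C) {k : ℕ} (A : BAFormula k) (v : Fin k → B) : A.Sat (f ∘ v) ↔ A.Sat v := by
  induction A with
  | top | bot => rfl
  | ne a b => simp only [Sat, ← BATerm.map_eval, ne_eq, f.injective.eq_iff]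
  | eq a b => simp only [Sat, ← BATerm.map_eval, f.injective.eq_iff]
  | imp A B ihA ihB => simp only [Sat, ihA, ihB]
  | or A B ihA ihB => simp only [Sat, ihA, ihB]
  | and A B ihA ihB => simp only [Sat, ihA, ihB]
  | all A ih =>
    simp only [Sat, f.surjective.forall, ← ih]
    refine forall_congr' fun x => iff_of_eq (congrArg A.Sat ?_)
    funext y
    exact Fin.cases rfl (fun y => rfl) y

theorem nonempty_orderIso_set {B : Type*} [BooleanAlgebra B] [Finite B] {n : ℕ}
    (h : Nat.card B = 2 ^ n) : Nonempty (B ≃o Set (Fin n)) := by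
  have := Fintype.ofFinite B
  let f : B ≃o Set {a : B // IsAtom a} :=
    letI := Fintype.toCompleteAtomicBooleanAlgebra B
    CompleteAtomicBooleanAlgebra.toSetOfIsAtom
  have hcard : Nat.card {a : B // IsAtom a} = n := by
    have := Fintype.ofFinite {a : B // IsAtom a}
    have h' := Nat.card_congr f.toEquiv
    rw [h, Nat.card_eq_fintype_card, Fintype.card_set] at h'
    rw [Nat.card_eq_fintype_card]
    exact (Nat.pow_right_injective le_rfl h').symm
  let g : {a : B // IsAtom a} ≃ Fin n := Finite.equivFinOfCardEq hcard
  exact ⟨f.trans ⟨Equiv.Set.congr g, by simp [Equiv.Set.congr]⟩⟩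

theorem BAFormula.trueIn_close {B : Type*} [BooleanAlgebra B] {k : ℕ} (A : BAFormula k) :
    A.close.TrueIn B ↔ ∀ v : Fin k → B, A.Sat v := by
  induction k with
  | zero => exact ⟨fun h v => Subsingleton.elim Fin.elim0 v ▸ h, fun h => h _⟩
  | succ k ih =>
    rw [close, ih]
    exact ⟨fun h v => Fin.cons_self_tail v ▸ h (Fin.tail v) (v 0), fun h v x => h _⟩

theorem BAFormula.sat_bigOr {B : Type*} [BooleanAlgebra B] {k : ℕ} (l : List (BAFormula k))
    (v : Fin k → B) : (bigOr l).Sat v ↔ ∃ A ∈ l, A.Sat v := by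
  have key (l : List (BAFormula k)) :
      ∀ A, (l.foldl BAFormula.or A).Sat v ↔ A.Sat v ∨ ∃ A' ∈ l, A'.Sat v := by
    induction l with
    | nil => simp
    | cons A' l ih => simp [ih, Sat, or_assoc]
  cases l with
  | nil => simp [bigOr, Sat]
  | cons A l => simp [bigOr, key]

theorem BAFormula.trueIn_fewerThan {B : Type*} [BooleanAlgebra B] [Finite B] (m : ℕ) :
    (fewerThan m).TrueIn B ↔ Nat.card B < m := by
  have := Fintype.ofFinite B
  have hsat (v : Fin m → B) : (bigOr (((List.finRange m ×ˢ List.finRange m).filter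
      (fun p => p.1 ≠ p.2)).map (fun p => .eq (.var p.1) (.var p.2)))).Sat v ↔
        ¬ Function.Injective v := by
    simp only [sat_bigOr, Function.not_injective_iff]
    constructor
    · rintro ⟨_, hA, hv⟩
      obtain ⟨⟨x, y⟩, hp, rfl⟩ := List.mem_map.1 hA
      exact ⟨x, y, hv, by simpa using (List.mem_filter.1 hp).2⟩
    · rintro ⟨x, y, hv, hxy⟩
      refine ⟨_, List.mem_map.2 ⟨(x, y), List.mem_filter.2 ⟨?_, by simpa using hxy⟩, rfl⟩, hv⟩
      exact List.pair_mem_product.2 ⟨List.mem_finRange x, List.mem_finRange y⟩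
  rw [fewerThan, trueIn_close, Nat.card_eq_fintype_card, ← not_le]
  simp only [hsat]
  rw [← not_exists, not_iff_not]
  constructor
  · rintro ⟨v, hv⟩
    simpa using Fintype.card_le_of_injective v hv
  · intro h
    obtain ⟨v⟩ := Function.Embedding.nonempty_of_card_le (α := Fin m) (β := B) (by simpa using h)
    exact ⟨v, v.injective⟩

end ClassicalRealizability

open ClassicalRealizability
theorem mainTheorem1 (n : ℕ) (hn : 0 < n) :
    ∃ S : RealizabilityStructure,
      S.Consistent ∧
      gimelEq (2 ^ n) ∈ S.theory ∧
      (∀ m : ℕ, gimelLE (2 ^ m) ∈ S.theory ↔ n ≤ m) ∧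
      ∀ (B : Type*) [BooleanAlgebra B] [Finite B], Nat.card B = 2 ^ n →
        ∀ A : BAFormula 0, A.gimel ∈ S.theory ↔ A.TrueIn B := by
  have hcard : Nat.card (Set (Fin n)) = 2 ^ n := by simp [Nat.card_eq_fintype_card]
  have hlt (m : ℕ) : (BAFormula.fewerThan m).TrueIn (Set (Fin n)) ↔ 2 ^ n < m := by
    rw [BAFormula.trueIn_fewerThan, hcard]
  refine ⟨coordStructure n, coordStructure_consistent hn, ?_, fun m => ?_, fun B _ _ hB A => ?_⟩
  · -- The formula `gimelEq (2 ^ n)` is itself the translation of a formula on Boolean algebras.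
    have h : (BAFormula.and (.imp (.fewerThan (2 ^ n)) .bot) (.fewerThan (2 ^ n + 1))).TrueIn
        (Set (Fin n)) := by
      refine And.intro (fun h => ?_) ((hlt _).2 (Nat.lt_succ_self _))
      exact lt_irrefl _ ((hlt _).1 h)
    exact (gimel_mem_theory_iff hn _).2 h
  · rw [gimelLE, gimelLT, gimel_mem_theory_iff hn, hlt, Nat.lt_succ_iff,
      Nat.pow_le_pow_iff_right one_lt_two]
  · obtain ⟨f⟩ := nonempty_orderIso_set hB
    rw [gimel_mem_theory_iff hn, BAFormula.TrueIn, BAFormula.TrueIn, ← A.sat_comp_orderIso f,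
      Subsingleton.elim (f ∘ Fin.elim0) Fin.elim0]
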